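/- Let $d\in\mathbb N$ and, for $p\in(1,\infty)$, let $F_p:\mathbb R^d\to\mathbb R^d$ be defined by $F_p(a):=|a|^{\frac{p-2}{2}}a$ (with $F_p(0)=0$). There exists a continuous function $c:(1,\infty)\to(0,\infty)$, depending only on $d$, such that the following holds for every $p\in(1,\infty)$, every bounded domain (non-empty, open, connected set) $\Omega\subseteq\mathbb R^d$, every $f\in W^{1,p}(\Omega)^*$ and every closed linear subspace $U\subseteq W^{1,p}(\Omega)$ on which Poincaré's inequality holds, i.e., for which there is a constant $c_{\mathrm P}>0$ with $$\|v\|_{L^p(\Omega)}\le c_{\mathrm P}\,\|\nabla v\|_{L^p(\Omega)^d}\qquad\text{for all }v\in U.$$ Here $W^{1,p}(\Omega)$ is the space of real functions $v\in L^p(\Omega)$ with weak gradient $\nabla v\in L^p(\Omega)^d$, normed by $\|v\|_{L^p(\Omega)}+\|\nabla v\|_{L^p(\Omega)^d}$. Let $E:U\to\mathbb R$ be the $p$-Dirichlet energy $$E(v):=\frac1p\int_\Omega|\nabla v|^p\,\mathrm dx-\langle f,v\rangle_{W^{1,p}(\Omega)}.$$ (i) There exists a unique minimizer $u^*\in U$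 of $E:U\to\mathbb R$. (ii) For every $v\in U$, $$c(p)^{-1}\,\rho_F^2(v,u^*)\le E(v)-E(u^*)\le c(p)\,\rho_F^2(v,u^*),\qquad\text{where }\ \rho_F^2(v,w):=\|F_p(\nabla v)-F_p(\nabla w)\|_{L^2(\Omega)^d}^2 .$$ -/

import Mathlib

open MeasureTheory
open scoped ContDiff ENNReal

noncomputable section

namespace PDirichlet

/-- An exponent `p ∈ (1, ∞)` is an admissible Lebesgue exponent. -/
instance fact_one_le_ofReal (p : ℝ) [hp : Fact (1 < p)] : Fact (1 ≤ ENNReal.ofReal p) :=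
  ⟨by simpa using ENNReal.ofReal_le_ofReal hp.out.le⟩

/-- The Lebesgue space `L^p(Ω)` of real functions. -/
abbrev LpFun {d : ℕ} (Ω : Set (EuclideanSpace ℝ (Fin d))) (p : ℝ) :=
  Lp ℝ (ENNReal.ofReal p) (volume.restrict Ω)

/-- The Lebesgue space `L^p(Ω)^d` of vector fields, with the Euclidean norm on `ℝ^d`. -/
abbrev LpVec {d : ℕ} (Ω : Set (EuclideanSpace ℝ (Fin d))) (p : ℝ) :=
  Lp (EuclideanSpace ℝ (Fin d)) (ENNReal.ofReal p) (volume.restrict Ω)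

/-- `g` is the weak (distributional) gradient of `u` on `Ω`:
`∫_Ω u ∂ᵢφ = - ∫_Ω gᵢ φ` for all test functions `φ ∈ C_c^∞(Ω)` and all `i`. -/
def IsWeakGradient {d : ℕ} (Ω : Set (EuclideanSpace ℝ (Fin d)))
    (u : EuclideanSpace ℝ (Fin d) → ℝ)
    (g : EuclideanSpace ℝ (Fin d) → EuclideanSpace ℝ (Fin d)) : Prop :=
  ∀ φ : EuclideanSpace ℝ (Fin d) → ℝ, ContDiff ℝ ∞ φ → HasCompactSupport φ → tsupport φ ⊆ Ω →
    ∀ i : Fin d,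
      ∫ x in Ω, fderiv ℝ φ x (EuclideanSpace.single i 1) * u x = - ∫ x in Ω, φ x * g x i

section Aux

variable {d : ℕ} {Ω : Set (EuclideanSpace ℝ (Fin d))} {p : ℝ}

theorem integrable_mul_fun [Fact (1 < p)] (u : LpFun Ω p) {φ : EuclideanSpace ℝ (Fin d) → ℝ}
    (hφ : Continuous φ) (hc : HasCompactSupport φ) :
    Integrable (fun x => φ x * u x) (volume.restrict Ω) :=
  ((Lp.memLp u).locallyIntegrable
    (fact_one_le_ofReal p).out).integrable_smul_left_of_hasCompactSupport hφ hc

theorem memLp_coord (g : LpVec Ω p) (i : Fin d) :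
    MemLp (fun x => g x i) (ENNReal.ofReal p) (volume.restrict Ω) :=
  (EuclideanSpace.proj i : EuclideanSpace ℝ (Fin d) →L[ℝ] ℝ).comp_memLp' (Lp.memLp g)

theorem integrable_mul_coord [Fact (1 < p)] (g : LpVec Ω p) (i : Fin d) {φ : EuclideanSpace ℝ (Fin d) → ℝ}
    (hφ : Continuous φ) (hc : HasCompactSupport φ) :
    Integrable (fun x => φ x * g x i) (volume.restrict Ω) :=
  ((memLp_coord g i).locallyIntegrable
    (fact_one_le_ofReal p).out).integrable_smul_left_of_hasCompactSupport hφ hc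

theorem continuous_partial {φ : EuclideanSpace ℝ (Fin d) → ℝ} (hφ : ContDiff ℝ ∞ φ)
    (e : EuclideanSpace ℝ (Fin d)) : Continuous fun x => fderiv ℝ φ x e :=
  (hφ.continuous_fderiv (by simp)).clm_apply continuous_const

theorem hasCompactSupport_partial {φ : EuclideanSpace ℝ (Fin d) → ℝ} (hc : HasCompactSupport φ)
    (e : EuclideanSpace ℝ (Fin d)) : HasCompactSupport fun x => fderiv ℝ φ x e :=
  hc.fderiv_apply ℝ e

theorem isWeakGradient_zero : IsWeakGradient Ω (0 : LpFun Ω p) (0 : LpVec Ω p) := by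
  intro φ hφ hc hs i
  have h1 : ∫ x in Ω, fderiv ℝ φ x (EuclideanSpace.single i 1) * (0 : LpFun Ω p) x = 0 := by
    refine integral_eq_zero_of_ae ?_
    filter_upwards [Lp.coeFn_zero ℝ (ENNReal.ofReal p) (volume.restrict Ω)] with x hx
    simp only [hx, Pi.zero_apply, mul_zero]
  have h2 : ∫ x in Ω, φ x * (0 : LpVec Ω p) x i = 0 := by
    refine integral_eq_zero_of_ae ?_
    filter_upwards [Lp.coeFn_zero (EuclideanSpace ℝ (Fin d)) (ENNReal.ofReal p)
      (volume.restrict Ω)] with x hx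
    simp only [hx, Pi.zero_apply, PiLp.zero_apply, mul_zero]
  rw [h1, h2, neg_zero]

theorem isWeakGradient_add [Fact (1 < p)] {u v : LpFun Ω p} {g h : LpVec Ω p} (hu : IsWeakGradient Ω u g)
    (hv : IsWeakGradient Ω v h) : IsWeakGradient Ω (u + v : LpFun Ω p) (g + h : LpVec Ω p) := by
  intro φ hφ hc hs i
  have h1 : ∫ x in Ω, fderiv ℝ φ x (EuclideanSpace.single i 1) * (u + v : LpFun Ω p) x
      = (∫ x in Ω, fderiv ℝ φ x (EuclideanSpace.single i 1) * u x)
        + ∫ x in Ω, fderiv ℝ φ x (EuclideanSpace.single i 1) * v x := by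
    rw [← integral_add
      (integrable_mul_fun u (continuous_partial hφ _) (hasCompactSupport_partial hc _))
      (integrable_mul_fun v (continuous_partial hφ _) (hasCompactSupport_partial hc _))]
    refine integral_congr_ae ?_
    filter_upwards [Lp.coeFn_add u v] with x hx
    simp only [hx, Pi.add_apply, mul_add]
  have h2 : ∫ x in Ω, φ x * (g + h : LpVec Ω p) x i
      = (∫ x in Ω, φ x * g x i) + ∫ x in Ω, φ x * h x i := by
    rw [← integral_add (integrable_mul_coord g i hφ.continuous hc)
      (integrable_mul_coord h i hφ.continuous hc)]
    refine integral_congr_ae ?_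
    filter_upwards [Lp.coeFn_add g h] with x hx
    simp only [hx, Pi.add_apply, PiLp.add_apply, mul_add]
  rw [h1, h2, hu φ hφ hc hs i, hv φ hφ hc hs i]
  ring

theorem isWeakGradient_smul (c : ℝ) {u : LpFun Ω p} {g : LpVec Ω p} (hu : IsWeakGradient Ω u g) :
    IsWeakGradient Ω (c • u : LpFun Ω p) (c • g : LpVec Ω p) := by
  intro φ hφ hc hs i
  have h1 : ∫ x in Ω, fderiv ℝ φ x (EuclideanSpace.single i 1) * (c • u : LpFun Ω p) x
      = c * ∫ x in Ω, fderiv ℝ φ x (EuclideanSpace.single i 1) * u x := by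
    rw [← integral_const_mul]
    refine integral_congr_ae ?_
    filter_upwards [Lp.coeFn_smul c u] with x hx
    simp [hx]
    ring
  have h2 : ∫ x in Ω, φ x * (c • g : LpVec Ω p) x i = c * ∫ x in Ω, φ x * g x i := by
    rw [← integral_const_mul]
    refine integral_congr_ae ?_
    filter_upwards [Lp.coeFn_smul c g] with x hx
    simp [hx]
    ring
  rw [h1, h2, hu φ hφ hc hs i]
  ring

end Aux

/-- The Sobolev space `W^{1,p}(Ω)`, realised as the space of all pairs `(u, ∇u)` with `u ∈ L^p(Ω)`
and weak gradient `∇u ∈ L^p(Ω)^d`. The gradient is determined by `u` (see `fn_injective`), and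
the inherited norm is `‖u‖_{W^{1,p}} = ‖u‖_{L^p} + ‖∇u‖_{L^p}` (see `norm_W1p`). -/
def W1p {d : ℕ} (Ω : Set (EuclideanSpace ℝ (Fin d))) (p : ℝ) [Fact (1 < p)] :
    Submodule ℝ (WithLp 1 (LpFun Ω p × LpVec Ω p)) where
  carrier := {w | IsWeakGradient Ω w.fst w.snd}
  zero_mem' := isWeakGradient_zero
  add_mem' := fun ha hb => isWeakGradient_add ha hb
  smul_mem' := fun c _ hu => isWeakGradient_smul c hu

section Sobolev

variable {d : ℕ} {Ω : Set (EuclideanSpace ℝ (Fin d))} {p : ℝ} [Fact (1 < p)]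

/-- The function `u ∈ L^p(Ω)` underlying an element of `W^{1,p}(Ω)`. -/
def fn (v : W1p Ω p) : LpFun Ω p := (v : WithLp 1 (LpFun Ω p × LpVec Ω p)).fst

/-- The weak gradient `∇u ∈ L^p(Ω)^d` of an element of `W^{1,p}(Ω)`. -/
def grad (v : W1p Ω p) : LpVec Ω p := (v : WithLp 1 (LpFun Ω p × LpVec Ω p)).snd

theorem isWeakGradient_grad (v : W1p Ω p) : IsWeakGradient Ω (fn v) (grad v) := v.2

theorem norm_W1p (v : W1p Ω p) : ‖v‖ = ‖fn v‖ + ‖grad v‖ :=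
  WithLp.prod_norm_eq_of_L1 (v : WithLp 1 (LpFun Ω p × LpVec Ω p))

/-- On an open set, an element of `W^{1,p}(Ω)` is determined by its underlying function. -/
theorem fn_injective (hΩ : IsOpen Ω) :
    Function.Injective (fn : W1p Ω p → LpFun Ω p) := by
  intro v w hvw
  have hg : grad v = grad w := by
    refine Lp.ext ?_
    have key : ∀ i : Fin d, ∀ᵐ x ∂(volume.restrict Ω), grad v x i - grad w x i = 0 := by
      intro i
      have hmem := (memLp_coord (grad v) i).sub (memLp_coord (grad w) i)
      have hloc := hmem.locallyIntegrable (fact_one_le_ofReal p).out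
      have := hΩ.ae_eq_zero_of_integral_contDiff_smul_eq_zero
        (hloc.locallyIntegrableOn Ω) (fun φ hφ hc hs => by
          have e1 := isWeakGradient_grad v φ hφ hc hs i
          have e2 := isWeakGradient_grad w φ hφ hc hs i
          rw [hvw, e2] at e1
          have : ∫ x in Ω, φ x • ((fun x => grad v x i) - fun x => grad w x i) x
              = (∫ x in Ω, φ x * grad v x i) - ∫ x in Ω, φ x * grad w x i := by
            rw [← integral_sub (integrable_mul_coord (grad v) i hφ.continuous hc)
              (integrable_mul_coord (grad w) i hφ.continuous hc)]
            refine integral_congr_ae (Filter.Eventually.of_forall fun x => ?_)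
            simp [mul_sub]
          rw [this]
          linarith)
      filter_upwards [this, ae_restrict_mem hΩ.measurableSet] with x hx hxΩ
      exact hx hxΩ
    filter_upwards [ae_all_iff.2 key] with x hx
    ext i
    exact sub_eq_zero.1 (hx i)
  refine Subtype.ext ((WithLp.ofLp_injective 1) (Prod.ext hvw hg))

end Sobolev

/-- The nonlinear map `F(a) = |a|^{(p-2)/2} a` on `ℝ^d`. -/
def F {d : ℕ} (p : ℝ) (a : EuclideanSpace ℝ (Fin d)) : EuclideanSpace ℝ (Fin d) :=
  ‖a‖ ^ ((p - 2) / 2) • a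

/-- The natural distance `ρ_F²(v, w) = ‖F(∇v) - F(∇w)‖²_{L²(Ω)^d}`. -/
def rhoSq {d : ℕ} {Ω : Set (EuclideanSpace ℝ (Fin d))} {p : ℝ} [Fact (1 < p)]
    (v w : W1p Ω p) : ℝ :=
  ∫ x in Ω, ‖F p (grad v x) - F p (grad w x)‖ ^ 2

/-- The `p`-Dirichlet energy `E(v) = (1/p) ∫_Ω |∇v|^p dx - ⟨f, v⟩` for `f ∈ W^{1,p}(Ω)^*`. -/
def energy {d : ℕ} {Ω : Set (EuclideanSpace ℝ (Fin d))} {p : ℝ} [Fact (1 < p)]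
    (f : StrongDual ℝ (W1p Ω p)) (v : W1p Ω p) : ℝ :=
  1 / p * (∫ x in Ω, ‖grad v x‖ ^ p) - f v

section Integrability

variable {d : ℕ} {Ω : Set (EuclideanSpace ℝ (Fin d))} {p : ℝ}

theorem integrable_norm_grad_rpow [hp : Fact (1 < p)] (v : W1p Ω p) :
    Integrable (fun x => ‖grad v x‖ ^ p) (volume.restrict Ω) := by
  have h0 : (0 : ℝ) < p := zero_lt_one.trans hp.out
  have := (Lp.memLp (grad v)).integrable_norm_rpow (by simpa using h0) ENNReal.ofReal_ne_top
  rwa [ENNReal.toReal_ofReal h0.le] at this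

theorem norm_F_sq (hp1 : 1 < p) (a : EuclideanSpace ℝ (Fin d)) : ‖F p a‖ ^ 2 = ‖a‖ ^ p := by
  rcases eq_or_ne a 0 with rfl | ha
  · simp [F, Real.zero_rpow (by linarith : p ≠ 0)]
  · have h : 0 < ‖a‖ := norm_pos_iff.2 ha
    rw [F, norm_smul, Real.norm_of_nonneg (Real.rpow_nonneg h.le _), mul_pow,
      ← Real.rpow_natCast, ← Real.rpow_mul h.le, ← Real.rpow_natCast ‖a‖, ← Real.rpow_add h]
    congr 1
    push_cast
    ring

theorem memLp_F_grad [hp : Fact (1 < p)] (v : W1p Ω p) :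
    MemLp (fun x => F p (grad v x)) 2 (volume.restrict Ω) := by
  have hm : Measurable (F p : EuclideanSpace ℝ (Fin d) → EuclideanSpace ℝ (Fin d)) := by
    unfold F
    exact (measurable_norm.pow_const _).smul measurable_id
  have hs : AEStronglyMeasurable (fun x => F p (grad v x)) (volume.restrict Ω) :=
    (hm.comp_aemeasurable (Lp.aestronglyMeasurable (grad v)).aemeasurable).aestronglyMeasurable
  refine (memLp_two_iff_integrable_sq_norm hs).2 ?_
  simpa only [norm_F_sq hp.out] using integrable_norm_grad_rpow v

/-- `ρ_F²(v, w)` is a genuine (convergent) squared `L²` norm. -/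
theorem integrable_rhoSq [Fact (1 < p)] (v w : W1p Ω p) :
    Integrable (fun x => ‖F p (grad v x) - F p (grad w x)‖ ^ 2) (volume.restrict Ω) :=
  ((memLp_F_grad v).sub (memLp_F_grad w)).integrable_norm_pow (by norm_num)

end Integrability

end PDirichlet

end

noncomputable section

namespace PDirichlet

/-! Everything rests on a pointwise fact (`bregman_bounds`): the Bregman distance of a ↦ |a|^p/p is
comparable to |F(a) - F(b)|², with constants θ(1-θ)/2 and 2, where θ = 1/p. Hence c(p) = 2p²/(p-1)
works, independently even of d.

For a minimizer u, the first variation of E vanishes on the subspace U. So E(v) - E(u) is exactly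
the integral of the Bregman distance from ∇u to ∇v (`energy_sub_eq_integral_bregman`). Integrating
the pointwise bounds gives (ii), and the lower one forces uniqueness.

Existence uses no weak compactness. Comparing with midpoints, the same lower bound makes ρ_F² small
along a minimizing sequence (`rhoSq_le_energy`). Bounded gradients that are close in ρ_F² are close
in L^p (`exists_norm_grad_sub_rpow_le`), so by Poincaré the sequence is Cauchy in the complete space
W^{1,p}, and its limit minimizes by continuity of E. -/

/-! ### Scalar inequalities from Bernoulli. -/

/-- Bernoulli bounds y^(2θ) directly if 2θ ≤ 1, and through y · y^(2θ-1) otherwise. What remains is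
exactly θ(y-1)² or (1-θ)(y-1)². This is the case of parallel a, b in `bregman_bounds`. -/
theorem mul_sq_sub_one_le_sub_rpow {θ y : ℝ} (h0 : 0 < θ) (h1 : θ < 1) (hy : 0 ≤ y) :
    θ * (1 - θ) * (y - 1) ^ 2 ≤ θ * y ^ 2 + (1 - θ) - y ^ (2 * θ) := by
  rcases le_total (2 * θ) 1 with h | h
  · have := rpow_one_add_le_one_add_mul_self (s := y - 1) (by linarith) (p := 2 * θ) (by linarith) h
    rw [add_sub_cancel] at this
    nlinarith [mul_nonneg (mul_nonneg h0.le h0.le) (sq_nonneg (y - 1))]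
  · have := rpow_one_add_le_one_add_mul_self (s := y - 1) (by linarith) (p := 2 * θ - 1)
      (by linarith) (by linarith)
    rw [add_sub_cancel] at this
    have hy2 : y ^ (2 * θ) = y * y ^ (2 * θ - 1) := by
      rw [← Real.rpow_one_add' hy (by linarith)]
      congr 1
      ring
    rw [hy2]
    have := mul_le_mul_of_nonneg_left this hy
    nlinarith [mul_nonneg (mul_nonneg (sub_nonneg.2 h1.le) (sub_nonneg.2 h1.le)) (sq_nonneg (y - 1))]

theorem sub_rpow_le_sq_sub_one {θ y : ℝ} (h0 : 0 < θ) (h1 : θ < 1) (hy : 0 ≤ y) :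
    θ * y ^ 2 + (1 - θ) - y ^ (2 * θ) ≤ (y - 1) ^ 2 := by
  rcases le_total 1 (2 * θ) with h | h
  · have := one_add_mul_self_le_rpow_one_add (s := y - 1) (by linarith) (p := 2 * θ) h
    rw [add_sub_cancel] at this
    nlinarith [mul_nonneg (sub_nonneg.2 h1.le) (sq_nonneg (y - 1))]
  · have := rpow_one_add_le_one_add_mul_self (s := y - 1) (by linarith) (p := 1 - 2 * θ)
      (by linarith) (by linarith)
    rw [add_sub_cancel] at this
    -- A lower bound on y^(2θ) is needed, but 2θ ≤ 1 makes Bernoulli an upper bound. Applying it to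
    -- the complementary power turns it around.
    have hy2 : y = y ^ (2 * θ) * y ^ (1 - 2 * θ) := by
      rw [← Real.rpow_add' hy (by norm_num)]
      simp
    have hm := mul_le_mul_of_nonneg_left this (Real.rpow_nonneg hy (2 * θ))
    rw [← hy2] at hm
    set z := y ^ (2 * θ)
    have hpos : 0 < 1 + (1 - 2 * θ) * (y - 1) := by nlinarith [mul_nonneg (sub_nonneg.2 h) hy]
    have hz : θ * y ^ 2 + (1 - θ) - (y - 1) ^ 2 ≤ z := by
      refine le_of_mul_le_mul_right ?_ hpos
      refine le_trans ?_ hm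
      nlinarith [mul_nonneg (mul_nonneg (mul_nonneg (sub_nonneg.2 h) (sub_nonneg.2 h1.le)) hy)
          (sq_nonneg (y - 1)), mul_nonneg (mul_nonneg h0.le (sub_nonneg.2 h)) (sq_nonneg (y - 1)),
          mul_nonneg h0.le (sq_nonneg (y - 1))]
    linarith

/-! ### Pointwise comparison of the Bregman distance with F. -/

variable {d : ℕ} {p : ℝ}

/-- The Bregman distance of `a ↦ |a|^p / p`. -/
def bregman (p : ℝ) (a b : EuclideanSpace ℝ (Fin d)) : ℝ :=
  1 / p * ‖a‖ ^ p - 1 / p * ‖b‖ ^ p - ‖b‖ ^ (p - 2) * inner ℝ b (a - b)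

theorem F_zero : F p (0 : EuclideanSpace ℝ (Fin d)) = 0 := by simp [F]

theorem norm_F_sub_F_sq (hp : 1 < p) (a b : EuclideanSpace ℝ (Fin d)) :
    ‖F p a - F p b‖ ^ 2 = ‖a‖ ^ p + ‖b‖ ^ p
      - 2 * (‖a‖ ^ ((p - 2) / 2) * ‖b‖ ^ ((p - 2) / 2) * inner ℝ b a) := by
  rw [norm_sub_sq_real, norm_F_sq hp, norm_F_sq hp]
  simp only [F, inner_smul_left, inner_smul_right, real_inner_comm a b, conj_trivial]
  ring

theorem bregman_eq (a b : EuclideanSpace ℝ (Fin d)) (hp : 1 < p) :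
    bregman p a b = 1 / p * ‖a‖ ^ p + (1 - 1 / p) * ‖b‖ ^ p - ‖b‖ ^ (p - 2) * inner ℝ b a := by
  have : ‖b‖ ^ (p - 2) * ‖b‖ ^ 2 = ‖b‖ ^ p := by
    rw [← Real.rpow_natCast, ← Real.rpow_add' (norm_nonneg b) (by push_cast; linarith)]
    congr 1
    push_cast
    ring
  rw [bregman, inner_sub_right, real_inner_self_eq_norm_sq, mul_sub, this]
  ring

/-- All sides are affine in the cosine τ, so the endpoints τ = ±1 suffice. At τ = 1 these are `l1`
and `l2`; at τ = -1 nothing cancels and crude estimates do, using M ≤ θY² + (1-θ)Z² for the upper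
one. -/
theorem affine_bounds {θ τ Y Z M : ℝ} (h0 : 0 < θ) (h1 : θ < 1) (hτ1 : 0 ≤ 1 + τ) (hτ2 : 0 ≤ 1 - τ)
    (hY : 0 ≤ Y) (hZ : 0 ≤ Z) (hM : 0 ≤ M)
    (l1 : θ * (1 - θ) * (Y - Z) ^ 2 ≤ θ * Y ^ 2 + (1 - θ) * Z ^ 2 - M)
    (l2 : θ * Y ^ 2 + (1 - θ) * Z ^ 2 - M ≤ (Y - Z) ^ 2) :
    θ * (1 - θ) / 2 * (Y ^ 2 + Z ^ 2 - 2 * (τ * (Y * Z)))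
        ≤ θ * Y ^ 2 + (1 - θ) * Z ^ 2 - τ * M ∧
      θ * Y ^ 2 + (1 - θ) * Z ^ 2 - τ * M ≤ 2 * (Y ^ 2 + Z ^ 2 - 2 * (τ * (Y * Z))) := by
  have h1' : 0 < 1 - θ := sub_pos.2 h1
  have l3 : 0 ≤ θ * (1 - θ) * (Y - Z) ^ 2 := by positivity
  have hYZ : 0 ≤ Y * Z := by positivity
  have w1 : 0 ≤ θ * θ * Y ^ 2 := by positivity
  have w2 : 0 ≤ (1 - θ) * (1 - θ) * Z ^ 2 := by positivity
  have w3 : 0 ≤ (1 - θ) * Y ^ 2 := by positivity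
  have w4 : 0 ≤ θ * Z ^ 2 := by positivity
  constructor
  · have u1 : θ * (1 - θ) / 2 * (Y - Z) ^ 2 ≤ θ * Y ^ 2 + (1 - θ) * Z ^ 2 - M := by linarith
    have u2 : θ * (1 - θ) / 2 * (Y + Z) ^ 2 ≤ θ * Y ^ 2 + (1 - θ) * Z ^ 2 + M := by linarith
    have := mul_le_mul_of_nonneg_left u1 hτ1
    have := mul_le_mul_of_nonneg_left u2 hτ2
    linarith
  · have u1 : θ * Y ^ 2 + (1 - θ) * Z ^ 2 - M ≤ 2 * (Y - Z) ^ 2 := by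
      linarith [sq_nonneg (Y - Z)]
    have u2 : θ * Y ^ 2 + (1 - θ) * Z ^ 2 + M ≤ 2 * (Y + Z) ^ 2 := by linarith
    have := mul_le_mul_of_nonneg_left u1 hτ1
    have := mul_le_mul_of_nonneg_left u2 hτ2
    linarith

theorem bregman_bounds (hp : 1 < p) (a b : EuclideanSpace ℝ (Fin d)) :
    1 / p * (1 - 1 / p) / 2 * ‖F p a - F p b‖ ^ 2 ≤ bregman p a b ∧
      bregman p a b ≤ 2 * ‖F p a - F p b‖ ^ 2 := by
  rw [bregman_eq a b hp, norm_F_sub_F_sq hp]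
  have hp0 : 0 < p := by linarith
  have h0 : 0 < 1 / p := by positivity
  have h1 : 1 / p < 1 := by rw [div_lt_one hp0]; exact hp
  set θ := 1 / p with hθ
  have hk : θ * (1 - θ) / 2 ≤ θ := by nlinarith
  have hk' : θ * (1 - θ) / 2 ≤ 1 - θ := by nlinarith
  have hpa : 0 ≤ ‖a‖ ^ p := by positivity
  have hpb : 0 ≤ ‖b‖ ^ p := by positivity
  rcases eq_or_ne a 0 with rfl | ha
  · simp only [norm_zero, Real.zero_rpow hp0.ne', inner_zero_right, mul_zero, sub_zero, zero_add]
    constructor <;> nlinarith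
  rcases eq_or_ne b 0 with rfl | hb
  · simp only [norm_zero, Real.zero_rpow hp0.ne', inner_zero_left, mul_zero, sub_zero, add_zero]
    constructor <;> nlinarith
  have hr : 0 < ‖a‖ := norm_pos_iff.2 ha
  have hs : 0 < ‖b‖ := norm_pos_iff.2 hb
  have hin := abs_le.1 (abs_real_inner_le_norm b a)
  set r := ‖a‖
  set s := ‖b‖
  -- τ is the cosine of the angle between a and b, which is why zero vectors were split off.
  obtain ⟨τ, hτ⟩ : ∃ τ, inner ℝ b a = τ * (r * s) :=
    ⟨inner ℝ b a / (r * s), by field_simp⟩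
  have hrs : 0 < r * s := by positivity
  rw [hτ] at hin ⊢
  have hτ1 : 0 ≤ 1 + τ := by nlinarith
  have hτ2 : 0 ≤ 1 - τ := by nlinarith
  have e2 : ∀ x : ℝ, 0 < x → x ^ p = (x ^ (p / 2)) ^ 2 := fun x hx => by
    rw [← Real.rpow_natCast, ← Real.rpow_mul hx.le]
    congr 1
    push_cast
    ring
  have e3 : ∀ x : ℝ, 0 < x → x ^ ((p - 2) / 2) = x ^ (p / 2) / x := fun x hx => by
    rw [sub_div, div_self two_ne_zero, Real.rpow_sub_one hx.ne']
  have e4 : s ^ (p - 2) = (s ^ (p / 2)) ^ 2 / s ^ 2 := by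
    rw [← e2 s hs, Real.rpow_sub hs, Real.rpow_two]
  -- The scalar lemmas are used at y = (r/s)^(p/2), then multiplied by s^p = Z².
  have hM : ((r / s) ^ (p / 2)) ^ (2 * θ) = r / s := by
    rw [← Real.rpow_mul (by positivity), hθ]
    have : p / 2 * (2 * (1 / p)) = 1 := by field_simp
    rw [this, Real.rpow_one]
  have hy : 0 ≤ (r / s) ^ (p / 2) := by positivity
  have l1 := mul_sq_sub_one_le_sub_rpow h0 h1 hy
  have l2 := sub_rpow_le_sq_sub_one h0 h1 hy
  rw [hM, Real.div_rpow hr.le hs.le] at l1 l2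
  rw [e2 r hr, e2 s hs, e3 r hr, e3 s hs, e4]
  have hY : 0 < r ^ (p / 2) := by positivity
  have hZ : 0 < s ^ (p / 2) := by positivity
  set Y := r ^ (p / 2)
  set Z := s ^ (p / 2)
  have hZ2 : 0 ≤ Z ^ 2 := by positivity
  have l1 := mul_le_mul_of_nonneg_left l1 hZ2
  have l2 := mul_le_mul_of_nonneg_left l2 hZ2
  have hM0 : 0 ≤ Z ^ 2 * (r / s) := by positivity
  have g1 : Z ^ 2 / s ^ 2 * (τ * (r * s)) = τ * (Z ^ 2 * (r / s)) := by field_simp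
  have g2 : Y / r * (Z / s) * (τ * (r * s)) = τ * (Y * Z) := by field_simp
  have g3 : Z ^ 2 * (θ * (1 - θ) * (Y / Z - 1) ^ 2) = θ * (1 - θ) * (Y - Z) ^ 2 := by field_simp
  have g4 : Z ^ 2 * (θ * (Y / Z) ^ 2 + (1 - θ) - r / s)
      = θ * Y ^ 2 + (1 - θ) * Z ^ 2 - Z ^ 2 * (r / s) := by field_simp
  have g5 : Z ^ 2 * (Y / Z - 1) ^ 2 = (Y - Z) ^ 2 := by field_simp
  rw [g1, g2]
  rw [g3, g4] at l1
  rw [g4, g5] at l2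
  exact affine_bounds h0 h1 hτ1 hτ2 hY.le hZ.le hM0 l1 l2

theorem bregman_nonneg (hp : 1 < p) (a b : EuclideanSpace ℝ (Fin d)) : 0 ≤ bregman p a b := by
  refine le_trans ?_ (bregman_bounds hp a b).1
  have : 0 ≤ 1 - 1 / p := by
    rw [sub_nonneg, div_le_one (by linarith)]
    exact hp.le
  have : 0 < p := by linarith
  positivity

/-! ### Properties of F and control of |a - b|^p. -/

theorem norm_F (hp : 1 < p) (a : EuclideanSpace ℝ (Fin d)) : ‖F p a‖ = ‖a‖ ^ (p / 2) := by
  rw [← Real.sqrt_sq (norm_nonneg (F p a)), norm_F_sq hp, Real.sqrt_eq_rpow,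
    ← Real.rpow_mul (norm_nonneg a)]
  congr 1
  ring

theorem F_injective (hp : 1 < p) :
    Function.Injective (F p : EuclideanSpace ℝ (Fin d) → EuclideanSpace ℝ (Fin d)) := by
  intro a b h
  have hn : ‖a‖ = ‖b‖ := by
    have := congrArg norm h
    rw [norm_F hp, norm_F hp] at this
    exact (Real.rpow_left_inj (norm_nonneg a) (norm_nonneg b) (by linarith)).1 this
  rcases eq_or_ne a 0 with rfl | ha
  · rw [norm_zero] at hn
    exact (norm_eq_zero.1 hn.symm).symm
  · rw [F, F, ← hn] at h
    exact smul_right_injective _ (Real.rpow_pos_of_pos (norm_pos_iff.2 ha) _).ne' h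

theorem continuous_F (hp : 1 < p) :
    Continuous (F p : EuclideanSpace ℝ (Fin d) → EuclideanSpace ℝ (Fin d)) := by
  rw [continuous_iff_continuousAt]
  intro a
  rcases eq_or_ne a 0 with rfl | ha
  · rw [ContinuousAt, F_zero, tendsto_zero_iff_norm_tendsto_zero]
    simp only [norm_F hp]
    have : Continuous fun a : EuclideanSpace ℝ (Fin d) => ‖a‖ ^ (p / 2) :=
      continuous_norm.rpow_const fun _ => Or.inr (by linarith)
    simpa [Real.zero_rpow (by linarith : p / 2 ≠ 0)] using this.tendsto 0
  · exact (continuousAt_id.norm.rpow_const (Or.inl (norm_ne_zero_iff.2 ha))).smul continuousAt_id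

theorem F_smul (hp : 1 < p) {t : ℝ} (ht : 0 ≤ t) (a : EuclideanSpace ℝ (Fin d)) :
    F p (t • a) = t ^ (p / 2) • F p a := by
  rw [F, F, norm_smul, Real.norm_of_nonneg ht, Real.mul_rpow ht (norm_nonneg a), smul_smul,
    smul_smul]
  congr 1
  rw [mul_right_comm, ← Real.rpow_add_one' ht (by linarith)]
  congr 2
  ring

/-- By p-homogeneity in (a, b) it suffices to work on the unit sphere. On the compact set `K` where
the ε-term alone is not enough, a ≠ b, so injectivity and continuity of F bound |F(a) - F(b)| away
from 0. The ε-term lets p < 2 and p ≥ 2 be treated alike. -/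
theorem exists_norm_sub_rpow_le (hp : 1 < p) {ε : ℝ} (hε : 0 < ε) :
    ∃ C : ℝ, 0 ≤ C ∧ ∀ a b : EuclideanSpace ℝ (Fin d),
      ‖a - b‖ ^ p ≤ ε * (‖a‖ ^ p + ‖b‖ ^ p) + C * ‖F p a - F p b‖ ^ 2 := by
  have hp0 : 0 < p := by linarith
  let V := EuclideanSpace ℝ (Fin d)
  let K : Set (V × V) := Metric.sphere 0 1 ∩ {x | ε * (‖x.1‖ ^ p + ‖x.2‖ ^ p) ≤ ‖x.1 - x.2‖ ^ p}
  have hc1 : Continuous fun x : V × V => ε * (‖x.1‖ ^ p + ‖x.2‖ ^ p) :=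
    continuous_const.mul ((continuous_fst.norm.rpow_const fun _ => Or.inr hp0.le).add
      (continuous_snd.norm.rpow_const fun _ => Or.inr hp0.le))
  have hc2 : Continuous fun x : V × V => ‖x.1 - x.2‖ ^ p :=
    (continuous_fst.sub continuous_snd).norm.rpow_const fun _ => Or.inr hp0.le
  have hc3 : Continuous fun x : V × V => ‖F p x.1 - F p x.2‖ ^ 2 :=
    ((((continuous_F hp).comp continuous_fst).sub ((continuous_F hp).comp continuous_snd)).norm).pow 2
  have hK : IsCompact K := (isCompact_sphere 0 1).inter_right (isClosed_le hc1 hc2)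
  have hpos : ∀ x ∈ K, 0 < ‖F p x.1 - F p x.2‖ ^ 2 := by
    rintro ⟨a, b⟩ ⟨h1, h2⟩
    have hab : a ≠ b := by
      rintro rfl
      simp only [Set.mem_ofPred_eq, sub_self, norm_zero, Real.zero_rpow hp0.ne'] at h2
      have h3 : 0 ≤ ‖a‖ ^ p := by positivity
      have h4 : ‖a‖ ^ p = 0 := by nlinarith
      have h5 : ‖a‖ = 0 := (Real.rpow_eq_zero (norm_nonneg a) hp0.ne').1 h4
      simp [Prod.norm_def, h5] at h1
    have : 0 < ‖F p a - F p b‖ := norm_pos_iff.2 (sub_ne_zero.2 fun h => hab (F_injective hp h))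
    positivity
  obtain ⟨C, hC0, hC⟩ : ∃ C : ℝ, 0 ≤ C ∧ ∀ x ∈ K,
      ‖x.1 - x.2‖ ^ p ≤ C * ‖F p x.1 - F p x.2‖ ^ 2 := by
    obtain ⟨C, hC⟩ := hK.exists_bound_of_continuousOn (f := fun x => ‖x.1 - x.2‖ ^ p /
      ‖F p x.1 - F p x.2‖ ^ 2) (hc2.continuousOn.div hc3.continuousOn fun x hx => (hpos x hx).ne')
    refine ⟨max C 0, le_max_right _ _, fun x hx => ?_⟩
    rw [← div_le_iff₀ (hpos x hx)]
    exact ((le_abs_self _).trans (hC x hx)).trans (le_max_left _ _)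
  refine ⟨C, hC0, fun a b => ?_⟩
  rcases eq_or_ne (a, b) 0 with h0 | h0
  · obtain ⟨rfl, rfl⟩ := Prod.mk_eq_zero.1 h0
    simp [Real.zero_rpow hp0.ne']
  · have ht : 0 < ‖(a, b)‖ := norm_pos_iff.2 h0
    set t := ‖(a, b)‖ with htdef
    have main : ∀ a b : V, ‖(a, b)‖ = 1 →
        ‖a - b‖ ^ p ≤ ε * (‖a‖ ^ p + ‖b‖ ^ p) + C * ‖F p a - F p b‖ ^ 2 := by
      intro a b hab
      by_cases h : (a, b) ∈ K
      · have := hC _ h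
        have : 0 ≤ ε * (‖a‖ ^ p + ‖b‖ ^ p) := by positivity
        linarith
      · have : ‖a - b‖ ^ p < ε * (‖a‖ ^ p + ‖b‖ ^ p) := by
          by_contra hcon
          exact h ⟨by simpa using hab, not_lt.1 hcon⟩
        have : 0 ≤ C * ‖F p a - F p b‖ ^ 2 := by positivity
        linarith
    have hn : ‖(t⁻¹ • a, t⁻¹ • b)‖ = 1 := by
      rw [← Prod.smul_mk, norm_smul, ← htdef, norm_inv, norm_norm, inv_mul_cancel₀ ht.ne']
    have hm := main _ _ hn
    have hti : 0 ≤ t⁻¹ := by positivity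
    rw [F_smul hp hti, F_smul hp hti, ← smul_sub, ← smul_sub, norm_smul, norm_smul, norm_smul,
      norm_smul, Real.norm_of_nonneg hti, Real.norm_of_nonneg (Real.rpow_nonneg hti _),
      Real.mul_rpow hti (norm_nonneg _), Real.mul_rpow hti (norm_nonneg _),
      Real.mul_rpow hti (norm_nonneg _), mul_pow, ← Real.rpow_natCast (t⁻¹ ^ (p / 2)),
      ← Real.rpow_mul hti] at hm
    have e : p / 2 * ((2 : ℕ) : ℝ) = p := by
      push_cast
      ring
    rw [e] at hm
    refine le_of_mul_le_mul_left ?_ (Real.rpow_pos_of_pos (inv_pos.2 ht) p)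
    linarith

/-! ### The Bregman distance along a ray. -/

/-- Convexity, read off from nonnegative Bregman distances based at b + th, whose linear terms
cancel. It supplies the dominating function for the first variation. -/
theorem bregman_add_smul_le (hp : 1 < p) (b h : EuclideanSpace ℝ (Fin d)) {t : ℝ} (ht0 : 0 ≤ t)
    (ht1 : t ≤ 1) : bregman p (b + t • h) b ≤ t * bregman p (b + h) b := by
  have h1 := mul_nonneg (sub_nonneg.2 ht1) (bregman_nonneg hp b (b + t • h))
  have h2 := mul_nonneg ht0 (bregman_nonneg hp (b + h) (b + t • h))
  have e1 : b - (b + t • h) = -(t • h) := by abel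
  have e2 : b + h - (b + t • h) = (1 - t) • h := by
    rw [sub_smul, one_smul]
    abel
  simp only [bregman, e1, e2, add_sub_cancel_left, inner_neg_right, inner_smul_right] at *
  nlinarith

theorem tendsto_bregman_div (hp : 1 < p) (b h : EuclideanSpace ℝ (Fin d)) :
    Filter.Tendsto (fun t : ℝ => t⁻¹ * bregman p (b + t • h) b) (nhdsWithin 0 {0}ᶜ) (nhds 0) := by
  have hd := (hasFDerivAt_norm_rpow (b + (0 : ℝ) • h) hp).comp_hasDerivAt (0 : ℝ)
    ((((hasDerivAt_id (0 : ℝ)).smul_const h)).const_add b)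
  have hs := hasDerivAt_iff_tendsto_slope.1 hd
  simp only [one_smul, zero_smul, add_zero] at hs
  have := (hs.const_mul (1 / p)).sub_const (‖b‖ ^ (p - 2) * inner ℝ b h)
  have e : 1 / p * ((p * ‖b‖ ^ (p - 2)) • (innerSL ℝ) b) h - ‖b‖ ^ (p - 2) * inner ℝ b h = 0 := by
    have : p ≠ 0 := by linarith
    simp only [FunLike.coe_smul, Pi.smul_apply, innerSL_apply_apply, smul_eq_mul]
    field_simp
    ring
  rw [e] at this
  refine this.congr' ?_
  filter_upwards [self_mem_nhdsWithin] with t ht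
  have ht : t ≠ 0 := ht
  simp only [slope, bregman, Function.comp, vsub_eq_sub, smul_eq_mul, add_sub_cancel_left,
    inner_smul_right, sub_zero, id, zero_smul, add_zero]
  field_simp

set_option maxHeartbeats 1000000

open Filter Topology

variable {Ω : Set (EuclideanSpace ℝ (Fin d))}

/-! ### Completeness of W^{1,p}. -/

theorem continuous_integral_mul [hp : Fact (1 < p)] {φ : EuclideanSpace ℝ (Fin d) → ℝ}
    (hφ : Continuous φ) (hc : HasCompactSupport φ) :
    Continuous fun u : LpFun Ω p => ∫ x in Ω, φ x * u x := by
  have hpq := Real.HolderConjugate.conjExponent hp.out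
  have : ENNReal.HolderConjugate (ENNReal.ofReal p.conjExponent) (ENNReal.ofReal p) :=
    hpq.symm.ennrealOfReal
  have : Fact (1 ≤ ENNReal.ofReal p.conjExponent) :=
    have : Fact (1 < p.conjExponent) := ⟨hpq.symm.lt⟩
    inferInstance
  have hm : MemLp φ (ENNReal.ofReal p.conjExponent) (volume.restrict Ω) :=
    hφ.memLp_of_hasCompactSupport hc
  refine (((ContinuousLinearMap.mul ℝ ℝ).lpPairing (volume.restrict Ω)
    (ENNReal.ofReal p.conjExponent) (ENNReal.ofReal p) (hm.toLp φ)).continuous).congr fun u => ?_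
  rw [ContinuousLinearMap.lpPairing_eq_integral]
  refine integral_congr_ae ?_
  filter_upwards [hm.coeFn_toLp] with x hx
  simp [hx]

theorem continuous_integral_mul_coord [Fact (1 < p)] {φ : EuclideanSpace ℝ (Fin d) → ℝ}
    (hφ : Continuous φ) (hc : HasCompactSupport φ) (i : Fin d) :
    Continuous fun g : LpVec Ω p => ∫ x in Ω, φ x * g x i := by
  let π : EuclideanSpace ℝ (Fin d) →L[ℝ] ℝ := EuclideanSpace.proj i
  refine ((continuous_integral_mul (Ω := Ω) (p := p) hφ hc).comp
    (π.compLpL (ENNReal.ofReal p) (volume.restrict Ω)).continuous).congr fun g => ?_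
  refine integral_congr_ae ?_
  filter_upwards [π.coeFn_compLp g] with x hx
  exact congrArg (φ x * ·) hx

theorem isClosed_W1p [Fact (1 < p)] :
    IsClosed (W1p Ω p : Set (WithLp 1 (LpFun Ω p × LpVec Ω p))) := by
  have hE : (W1p Ω p : Set (WithLp 1 (LpFun Ω p × LpVec Ω p))) =
      {w | IsWeakGradient Ω w.fst w.snd} := rfl
  rw [hE]
  have hof := WithLp.prod_continuous_ofLp 1 (LpFun Ω p) (LpVec Ω p)
  simp only [IsWeakGradient, Set.ofPred_forall]
  refine isClosed_iInter fun φ => isClosed_iInter fun hφ => isClosed_iInter fun hc =>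
    isClosed_iInter fun _ => isClosed_iInter fun i => isClosed_eq ?_ ?_
  · exact (continuous_integral_mul (continuous_partial hφ _)
      (hasCompactSupport_partial hc _)).comp (continuous_fst.comp hof)
  · exact ((continuous_integral_mul_coord hφ.continuous hc i).comp
      (continuous_snd.comp hof)).neg

instance completeSpace_W1p [Fact (1 < p)] : CompleteSpace (W1p Ω p) :=
  isClosed_W1p.completeSpace_coe

/-! ### Energy expansion and first variation. -/

variable [hp : Fact (1 < p)]

theorem grad_add (v w : W1p Ω p) : grad (v + w) = grad v + grad w := rfl

theorem grad_sub (v w : W1p Ω p) : grad (v - w) = grad v - grad w := rfl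

theorem grad_smul (t : ℝ) (v : W1p Ω p) : grad (t • v) = t • grad v := rfl

theorem continuous_grad : Continuous (grad : W1p Ω p → LpVec Ω p) := by
  refine (LipschitzWith.of_dist_le_mul (K := 1) fun v w => ?_).continuous
  rw [dist_eq_norm, dist_eq_norm, ← grad_sub, norm_W1p]
  simp

theorem integral_norm_grad_rpow (v : W1p Ω p) : ∫ x in Ω, ‖grad v x‖ ^ p = ‖grad v‖ ^ p := by
  have h0 : 0 < p := zero_lt_one.trans hp.out
  rw [Lp.norm_def, (Lp.memLp (grad v)).eLpNorm_eq_integral_rpow_norm (by simpa using h0)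
    ENNReal.ofReal_ne_top, ENNReal.toReal_ofReal h0.le,
    ENNReal.toReal_ofReal (by positivity), ← Real.rpow_mul (by positivity),
    inv_mul_cancel₀ h0.ne', Real.rpow_one]

theorem energy_eq (f : StrongDual ℝ (W1p Ω p)) (v : W1p Ω p) :
    energy f v = 1 / p * ‖grad v‖ ^ p - f v := by
  rw [energy, integral_norm_grad_rpow]

theorem continuous_energy (f : StrongDual ℝ (W1p Ω p)) : Continuous (energy f) := by
  refine ((continuous_const.mul (continuous_grad.norm.rpow_const fun _ =>
    Or.inr (zero_lt_one.trans hp.out).le)).sub f.continuous).congr fun v => (energy_eq f v).symm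

theorem integrable_bregman (v u : W1p Ω p) :
    Integrable (fun x => bregman p (grad v x) (grad u x)) (volume.restrict Ω) := by
  have hv := (Lp.aestronglyMeasurable (grad v)).aemeasurable
  have hu := (Lp.aestronglyMeasurable (grad u)).aemeasurable
  refine ((integrable_rhoSq v u).const_mul 2).mono' ?_ (Eventually.of_forall fun x => ?_)
  · exact ((((hv.norm.pow_const p).const_mul _).sub ((hu.norm.pow_const p).const_mul _)).sub
      ((hu.norm.pow_const _).mul (hu.inner (hv.sub hu)))).aestronglyMeasurable
  · rw [Real.norm_of_nonneg (bregman_nonneg hp.out _ _)]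
    exact (bregman_bounds hp.out _ _).2

theorem integral_bregman_bounds (v u : W1p Ω p) :
    1 / p * (1 - 1 / p) / 2 * rhoSq v u ≤ ∫ x in Ω, bregman p (grad v x) (grad u x) ∧
      ∫ x in Ω, bregman p (grad v x) (grad u x) ≤ 2 * rhoSq v u := by
  constructor
  · rw [rhoSq, ← integral_const_mul]
    exact integral_mono ((integrable_rhoSq v u).const_mul _) (integrable_bregman v u)
      fun x => (bregman_bounds hp.out _ _).1
  · rw [rhoSq, ← integral_const_mul]
    exact integral_mono (integrable_bregman v u) ((integrable_rhoSq v u).const_mul _)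
      fun x => (bregman_bounds hp.out _ _).2

/-- The derivative of `v ↦ (1/p) ∫ |∇v|^p` at `u` in direction `h`. -/
def dirichletForm (u h : W1p Ω p) : ℝ :=
  ∫ x in Ω, ‖grad u x‖ ^ (p - 2) * inner ℝ (grad u x) (grad h x)

theorem dirichletForm_smul (u h : W1p Ω p) (t : ℝ) :
    dirichletForm u (t • h) = t * dirichletForm u h := by
  rw [dirichletForm, dirichletForm, ← integral_const_mul]
  refine integral_congr_ae ?_
  filter_upwards [Lp.coeFn_smul t (grad h)] with x hx
  rw [grad_smul, hx, Pi.smul_apply, inner_smul_right]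
  ring

theorem integral_bregman_add (u h : W1p Ω p) :
    ∫ x in Ω, bregman p (grad (u + h) x) (grad u x) =
      1 / p * (∫ x in Ω, ‖grad (u + h) x‖ ^ p) - 1 / p * (∫ x in Ω, ‖grad u x‖ ^ p)
        - dirichletForm u h := by
  have h1 := (integrable_norm_grad_rpow (u + h)).const_mul (1 / p)
  have h2 := (integrable_norm_grad_rpow u).const_mul (1 / p)
  -- Writing the integrand as a difference of integrable functions avoids a separate Hölder estimate
  -- for it.
  have e : dirichletForm u h = ∫ x in Ω, (1 / p * ‖grad (u + h) x‖ ^ p - 1 / p * ‖grad u x‖ ^ p)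
      - bregman p (grad (u + h) x) (grad u x) := by
    refine integral_congr_ae ?_
    filter_upwards [Lp.coeFn_add (grad u) (grad h)] with x hx
    rw [bregman, grad_add, hx, Pi.add_apply, add_sub_cancel_left]
    ring
  rw [e, integral_sub (by exact h1.sub h2) (integrable_bregman _ _), integral_sub h1 h2,
    integral_const_mul, integral_const_mul]
  generalize (∫ x in Ω, ‖grad (u + h) x‖ ^ p) = a
  generalize (∫ x in Ω, ‖grad u x‖ ^ p) = b
  ring
theorem energy_add_sub (f : StrongDual ℝ (W1p Ω p)) (u h : W1p Ω p) :
    energy f (u + h) - energy f u =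
      (∫ x in Ω, bregman p (grad (u + h) x) (grad u x)) + (dirichletForm u h - f h) := by
  rw [integral_bregman_add, energy, energy, f.map_add]
  generalize (∫ x in Ω, ‖grad (u + h) x‖ ^ p) = a
  ring

theorem tendsto_integral_bregman_div (u h : W1p Ω p) :
    Tendsto (fun t : ℝ => t⁻¹ * ∫ x in Ω, bregman p (grad (u + t • h) x) (grad u x))
      (𝓝[>] 0) (𝓝 0) := by
  have e : ∀ t : ℝ, ∀ᵐ x ∂(volume.restrict Ω), grad (u + t • h) x = grad u x + t • grad h x := by
    intro t
    filter_upwards [Lp.coeFn_add (grad u) (t • grad h), Lp.coeFn_smul t (grad h)] with x h1 h2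
    rw [grad_add, grad_smul, h1, Pi.add_apply, h2, Pi.smul_apply]
  have main : Tendsto (fun t : ℝ => ∫ x in Ω, t⁻¹ * bregman p (grad u x + t • grad h x) (grad u x))
      (𝓝[>] 0) (𝓝 (∫ _ in Ω, (0 : ℝ))) := by
    refine tendsto_integral_filter_of_dominated_convergence
      (fun x => bregman p (grad (u + (1 : ℝ) • h) x) (grad u x)) ?_ ?_ (integrable_bregman _ _) ?_
    · refine Eventually.of_forall fun t =>
        ((integrable_bregman (u + t • h) u).const_mul t⁻¹).aestronglyMeasurable.congr ?_
      filter_upwards [e t] with x hx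
      rw [hx]
    · filter_upwards [Ioc_mem_nhdsGT zero_lt_one] with t ht
      filter_upwards [e 1] with x hx
      rw [Real.norm_of_nonneg (mul_nonneg (inv_nonneg.2 ht.1.le) (bregman_nonneg hp.out _ _)), hx,
        one_smul, inv_mul_le_iff₀ ht.1]
      exact bregman_add_smul_le hp.out _ _ ht.1.le ht.2
    · exact Eventually.of_forall fun x => (tendsto_bregman_div hp.out _ _).mono_left
        (nhdsWithin_mono _ fun t ht => ne_of_gt ht)
  rw [integral_zero] at main
  refine main.congr fun t => ?_
  rw [← integral_const_mul]
  refine integral_congr_ae ?_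
  filter_upwards [e t] with x hx
  rw [hx]

theorem dirichletForm_sub_nonneg {f : StrongDual ℝ (W1p Ω p)} {U : Submodule ℝ (W1p Ω p)}
    {u : W1p Ω p} (hu : u ∈ U) (hmin : ∀ v ∈ U, energy f u ≤ energy f v) {h : W1p Ω p}
    (hh : h ∈ U) : 0 ≤ dirichletForm u h - f h := by
  have key : ∀ᶠ t : ℝ in 𝓝[>] 0, -(dirichletForm u h - f h) ≤
      t⁻¹ * ∫ x in Ω, bregman p (grad (u + t • h) x) (grad u x) := by
    filter_upwards [self_mem_nhdsWithin] with t ht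
    have ht : 0 < t := ht
    have h1 := energy_add_sub f u (t • h)
    have h2 := hmin _ (U.add_mem hu (U.smul_mem t hh))
    rw [dirichletForm_smul, f.map_smul, smul_eq_mul] at h1
    rw [inv_mul_eq_div, le_div_iff₀ ht]
    generalize u + t • h = w at h1 h2 ⊢
    linarith
  have := ge_of_tendsto (tendsto_integral_bregman_div u h) key
  linarith

/-- U is a subspace, so the one-sided first variation applies to both v - u and u - v, and the
linear term vanishes. -/
theorem energy_sub_eq_integral_bregman {f : StrongDual ℝ (W1p Ω p)} {U : Submodule ℝ (W1p Ω p)}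
    {u : W1p Ω p} (hu : u ∈ U) (hmin : ∀ v ∈ U, energy f u ≤ energy f v) {v : W1p Ω p}
    (hv : v ∈ U) :
    energy f v - energy f u = ∫ x in Ω, bregman p (grad v x) (grad u x) := by
  have h1 := dirichletForm_sub_nonneg hu hmin (U.sub_mem hv hu)
  have h2 := dirichletForm_sub_nonneg hu hmin (U.smul_mem (-1) (U.sub_mem hv hu))
  rw [dirichletForm_smul, f.map_smul, smul_eq_mul] at h2
  have h3 := energy_add_sub f u (v - u)
  rw [add_sub_cancel] at h3
  linarith

/-! ### Uniform convexity and existence. -/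

/-- Add the Bregman lower bounds for a and b based at their midpoint: the linear terms cancel, and
the parallelogram law costs a factor 2. -/
theorem norm_F_sub_sq_le (a b : EuclideanSpace ℝ (Fin d)) :
    1 / p * (1 - 1 / p) / 4 * ‖F p a - F p b‖ ^ 2 ≤
      1 / p * ‖a‖ ^ p + 1 / p * ‖b‖ ^ p - 2 * (1 / p * ‖(1 / 2 : ℝ) • (a + b)‖ ^ p) := by
  set m := (1 / 2 : ℝ) • (a + b) with hm
  have h1 := (bregman_bounds hp.out a m).1
  have h2 := (bregman_bounds hp.out b m).1
  have e : b - m = -(a - m) := by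
    rw [hm]
    module
  simp only [bregman, e, inner_neg_right] at h1 h2
  have h3 : ‖F p a - F p b‖ ^ 2 ≤ 2 * (‖F p a - F p m‖ ^ 2 + ‖F p b - F p m‖ ^ 2) := by
    have := parallelogram_law_with_norm ℝ (F p a - F p m) (F p b - F p m)
    rw [sub_sub_sub_cancel_right] at this
    nlinarith [sq_nonneg ‖F p a - F p m + (F p b - F p m)‖]
  have h4 : 0 ≤ 1 / p * (1 - 1 / p) / 4 := by
    have h0 : 0 < p := zero_lt_one.trans hp.out
    have : 0 ≤ 1 - 1 / p := by
      rw [sub_nonneg, div_le_one h0]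
      exact hp.out.le
    positivity
  have := mul_le_mul_of_nonneg_left h3 h4
  linarith

theorem rhoSq_le_energy (f : StrongDual ℝ (W1p Ω p)) (v w : W1p Ω p) :
    1 / p * (1 - 1 / p) / 4 * rhoSq v w ≤
      energy f v + energy f w - 2 * energy f ((1 / 2 : ℝ) • (v + w)) := by
  have h1 := (integrable_norm_grad_rpow v).const_mul (1 / p)
  have h2 := (integrable_norm_grad_rpow w).const_mul (1 / p)
  have h3 := ((integrable_norm_grad_rpow ((1 / 2 : ℝ) • (v + w))).const_mul (1 / p)).const_mul 2
  have key := integral_mono_ae ((integrable_rhoSq v w).const_mul (1 / p * (1 - 1 / p) / 4))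
    ((h1.add h2).sub h3) (by
      filter_upwards [Lp.coeFn_smul (1 / 2 : ℝ) (grad v + grad w),
        Lp.coeFn_add (grad v) (grad w)] with x e1 e2
      simp only [Pi.sub_apply, Pi.add_apply]
      rw [grad_smul, grad_add, e1, Pi.smul_apply, e2, Pi.add_apply]
      exact norm_F_sub_sq_le _ _)
  rw [integral_const_mul, integral_sub' (h1.add h2) h3, integral_add' h1 h2, integral_const_mul,
    integral_const_mul, integral_const_mul, integral_const_mul] at key
  rw [energy, energy, energy, f.map_smul, f.map_add, smul_eq_mul, rhoSq]
  generalize (∫ x in Ω, ‖grad ((1 / 2 : ℝ) • (v + w)) x‖ ^ p) = a at key ⊢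
  linarith

theorem exists_norm_grad_sub_rpow_le {ε : ℝ} (hε : 0 < ε) :
    ∃ C : ℝ, 0 ≤ C ∧ ∀ v w : W1p Ω p,
      ‖grad (v - w)‖ ^ p ≤ ε * (‖grad v‖ ^ p + ‖grad w‖ ^ p) + C * rhoSq v w := by
  obtain ⟨C, hC0, hC⟩ := exists_norm_sub_rpow_le (d := d) hp.out hε
  refine ⟨C, hC0, fun v w => ?_⟩
  have h1 := ((integrable_norm_grad_rpow v).add (integrable_norm_grad_rpow w)).const_mul ε
  have h2 := (integrable_rhoSq v w).const_mul C
  have key := integral_mono_ae (integrable_norm_grad_rpow (v - w)) (h1.add h2) (by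
    filter_upwards [Lp.coeFn_sub (grad v) (grad w)] with x e1
    rw [grad_sub, e1, Pi.sub_apply]
    exact hC _ _)
  rw [integral_add' h1 h2, integral_const_mul, integral_const_mul,
    integral_add' (integrable_norm_grad_rpow v) (integrable_norm_grad_rpow w)] at key
  simp only [integral_norm_grad_rpow] at key
  exact key

theorem le_energy_of_poincare (f : StrongDual ℝ (W1p Ω p)) {U : Submodule ℝ (W1p Ω p)} {cP : ℝ}
    (hcP : 0 < cP) (hU : ∀ v ∈ U, ‖fn v‖ ≤ cP * ‖grad v‖) :
    ∃ C : ℝ, ∀ v ∈ U, ‖grad v‖ - C ≤ energy f v := by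
  have hpq := Real.HolderConjugate.conjExponent hp.out
  -- The extra 1 leaves one ‖∇v‖ over after Young's inequality absorbs the functional.
  set A := ‖f‖ * (cP + 1) + 1
  refine ⟨A ^ p.conjExponent / p.conjExponent, fun v hv => ?_⟩
  have h1 := Real.young_inequality_of_nonneg (norm_nonneg (grad v))
    (by positivity : 0 ≤ A) hpq
  have h2 : f v ≤ ‖f‖ * ((cP + 1) * ‖grad v‖) :=
    (le_abs_self _).trans ((f.le_opNorm v).trans
      (mul_le_mul_of_nonneg_left (by rw [norm_W1p]; linarith [hU v hv]) (norm_nonneg f)))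
  rw [energy_eq, one_div_mul_eq_div]
  have h3 : ‖grad v‖ * A = ‖f‖ * ((cP + 1) * ‖grad v‖) + ‖grad v‖ := by ring
  linarith

theorem exists_minimizer (f : StrongDual ℝ (W1p Ω p)) {U : Submodule ℝ (W1p Ω p)}
    (hclosed : IsClosed (U : Set (W1p Ω p))) {cP : ℝ} (hcP : 0 < cP)
    (hU : ∀ v ∈ U, ‖fn v‖ ≤ cP * ‖grad v‖) :
    ∃ u ∈ U, ∀ v ∈ U, energy f u ≤ energy f v := by
  have h0 : 0 < p := zero_lt_one.trans hp.out
  have hθ : 0 < 1 / p * (1 - 1 / p) / 4 := by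
    have : 0 < 1 - 1 / p := by
      rw [sub_pos, div_lt_one h0]
      exact hp.out
    positivity
  obtain ⟨C, hC⟩ := le_energy_of_poincare f hcP hU
  have hbdd : BddBelow (energy f '' U) := by
    refine ⟨-C, ?_⟩
    rintro _ ⟨v, hv, rfl⟩
    linarith [hC v hv, norm_nonneg (grad v)]
  set I := sInf (energy f '' U)
  have hI : ∀ v ∈ U, I ≤ energy f v := fun v hv => csInf_le hbdd ⟨v, hv, rfl⟩
  have hex : ∀ n : ℕ, ∃ v ∈ U, energy f v < I + 1 / ((n : ℝ) + 1) := by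
    intro n
    obtain ⟨_, ⟨v, hv, rfl⟩, h⟩ := exists_lt_of_csInf_lt (s := energy f '' U)
      ⟨_, 0, U.zero_mem, rfl⟩ (lt_add_of_pos_right I (Nat.one_div_pos_of_nat (n := n)))
    exact ⟨v, hv, h⟩
  choose v hvU hv using hex
  have hlim : Tendsto (fun n : ℕ => I + 1 / ((n : ℝ) + 1)) atTop (𝓝 I) := by
    simpa using tendsto_one_div_add_atTop_nhds_zero_nat.const_add I
  set R := I + 1 + C
  have hR : ∀ n, ‖grad (v n)‖ ≤ R := fun n => by
    have h1 : 1 / ((n : ℝ) + 1) ≤ 1 := by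
      rw [div_le_one (by positivity)]
      linarith [n.cast_nonneg (α := ℝ)]
    linarith [hC _ (hvU n), hv n]
  have hR0 : 0 ≤ R := (norm_nonneg _).trans (hR 0)
  have hrho : ∀ N n m : ℕ, N ≤ n → N ≤ m →
      rhoSq (v n) (v m) ≤ (1 / p * (1 - 1 / p) / 4)⁻¹ * (2 * (1 / ((N : ℝ) + 1))) := by
    intro N n m hn hm
    rw [inv_mul_eq_div, le_div_iff₀ hθ]
    have h1 := rhoSq_le_energy f (v n) (v m)
    have h2 := hI _ (U.smul_mem (1 / 2 : ℝ) (U.add_mem (hvU n) (hvU m)))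
    generalize (1 / 2 : ℝ) • (v n + v m) = z at h1 h2
    have h3 := Nat.one_div_le_one_div (α := ℝ) hn
    have h4 := Nat.one_div_le_one_div (α := ℝ) hm
    linarith [hv n, hv m]
  have hcauchy : CauchySeq v := by
    rw [Metric.cauchySeq_iff]
    intro ε hε
    set δ := ε / (cP + 1)
    have hδ : 0 < δ := by positivity
    have hδp : 0 < δ ^ p := by positivity
    -- Both gradients have norm at most `R`, so this weight keeps the ε-term below δ^p/2; the ρ_F²
    -- term gets the other half.
    obtain ⟨D, hD0, hD⟩ := exists_norm_grad_sub_rpow_le (Ω := Ω) (p := p)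
      (ε := δ ^ p / (4 * (R ^ p + 1))) (by positivity)
    have hl : Tendsto (fun N : ℕ => D * ((1 / p * (1 - 1 / p) / 4)⁻¹ *
        (2 * (1 / ((N : ℝ) + 1))))) atTop (𝓝 0) := by
      simpa using ((tendsto_one_div_add_atTop_nhds_zero_nat (𝕜 := ℝ).const_mul 2).const_mul
        ((1 / p * (1 - 1 / p) / 4)⁻¹)).const_mul D
    obtain ⟨N, hN⟩ := (hl.eventually (gt_mem_nhds (half_pos hδp))).exists
    refine ⟨N, fun n hn m hm => ?_⟩
    have h1 := hD (v n) (v m)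
    have h6 := hU _ (U.sub_mem (hvU n) (hvU m))
    rw [dist_eq_norm, norm_W1p]
    generalize v n - v m = z at h1 h6 ⊢
    have h2 := mul_le_mul_of_nonneg_left (hrho N n m hn hm) hD0
    have h3 : ∀ k, ‖grad (v k)‖ ^ p ≤ R ^ p := fun k =>
      Real.rpow_le_rpow (norm_nonneg _) (hR k) h0.le
    have h4 : δ ^ p / (4 * (R ^ p + 1)) * (‖grad (v n)‖ ^ p + ‖grad (v m)‖ ^ p) ≤ δ ^ p / 2 := by
      have : 0 ≤ R ^ p := by positivity
      rw [div_mul_eq_mul_div, div_le_iff₀ (by positivity)]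
      nlinarith [h3 n, h3 m]
    have h5 : ‖grad z‖ < δ :=
      (Real.rpow_lt_rpow_iff (norm_nonneg _) hδ.le h0).1 (by linarith)
    have h7 : (cP + 1) * ‖grad z‖ < ε := by
      rwa [lt_div_iff₀' (by positivity)] at h5
    linarith
  obtain ⟨u, hu⟩ := cauchySeq_tendsto_of_complete hcauchy
  refine ⟨u, hclosed.mem_of_tendsto hu (Eventually.of_forall hvU), fun w hw => ?_⟩
  have hE := (continuous_energy f).continuousAt.tendsto.comp hu
  exact (le_of_tendsto_of_tendsto' hE hlim fun n => (hv n).le).trans (hI w hw)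

/-! ### Uniqueness and the two-sided bound. -/

theorem grad_eq_of_rhoSq_nonpos {v w : W1p Ω p} (h : rhoSq v w ≤ 0) : grad v = grad w := by
  have h0 : rhoSq v w = 0 := le_antisymm h (integral_nonneg fun x => by positivity)
  rw [rhoSq, integral_eq_zero_iff_of_nonneg (fun x => by positivity) (integrable_rhoSq v w)] at h0
  refine Lp.ext ?_
  filter_upwards [h0] with x hx
  exact F_injective hp.out (sub_eq_zero.1 (norm_eq_zero.1 (pow_eq_zero_iff two_ne_zero |>.1 hx)))

theorem eq_of_grad_eq {U : Submodule ℝ (W1p Ω p)} {cP : ℝ}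
    (hU : ∀ v ∈ U, ‖fn v‖ ≤ cP * ‖grad v‖) {v w : W1p Ω p} (hv : v ∈ U) (hw : w ∈ U)
    (h : grad v = grad w) : v = w := by
  have h1 := hU _ (U.sub_mem hv hw)
  have h2 : ‖grad (v - w)‖ = 0 := by rw [grad_sub, h, sub_self, norm_zero]
  rw [h2, mul_zero] at h1
  rw [← sub_eq_zero, ← norm_le_zero_iff, norm_W1p, h2]
  linarith

theorem modulus_bounds {p : ℝ} (hp : 1 < p) :
    0 < 1 / p * (1 - 1 / p) / 2 ∧ 1 / p * (1 - 1 / p) / 2 ≤ 1 / 2 := by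
  have h0 : 0 < 1 / p := by
    have : 0 < p := by linarith
    positivity
  have h1 : 0 < 1 - 1 / p := by
    rw [sub_pos, div_lt_one (by linarith)]
    exact hp
  exact ⟨by positivity, by nlinarith⟩

theorem energy_sub_bounds {f : StrongDual ℝ (W1p Ω p)} {U : Submodule ℝ (W1p Ω p)}
    {u : W1p Ω p} (hu : u ∈ U) (hmin : ∀ v ∈ U, energy f u ≤ energy f v) {v : W1p Ω p}
    (hv : v ∈ U) :
    1 / p * (1 - 1 / p) / 2 * rhoSq v u ≤ energy f v - energy f u ∧
      energy f v - energy f u ≤ (1 / p * (1 - 1 / p) / 2)⁻¹ * rhoSq v u := by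
  obtain ⟨hκ0, hκ1⟩ := modulus_bounds hp.out
  rw [energy_sub_eq_integral_bregman hu hmin hv]
  obtain ⟨h1, h2⟩ := integral_bregman_bounds v u
  refine ⟨h1, h2.trans (mul_le_mul_of_nonneg_right ?_ (integral_nonneg fun x => by positivity))⟩
  -- The modulus is at most 1/2, so its inverse also dominates the upper constant 2 and one c(p)
  -- serves both sides.
  rw [le_inv_comm₀ two_pos hκ0, inv_eq_one_div]
  exact hκ1

theorem existsUnique_minimizer (f : StrongDual ℝ (W1p Ω p)) {U : Submodule ℝ (W1p Ω p)}
    (hclosed : IsClosed (U : Set (W1p Ω p))) {cP : ℝ} (hcP : 0 < cP)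
    (hU : ∀ v ∈ U, ‖fn v‖ ≤ cP * ‖grad v‖) :
    ∃! u : W1p Ω p, u ∈ U ∧ ∀ v ∈ U, energy f u ≤ energy f v := by
  obtain ⟨u, hu, hmin⟩ := exists_minimizer f hclosed hcP hU
  refine ⟨u, ⟨hu, hmin⟩, fun v ⟨hv, hvmin⟩ => ?_⟩
  refine eq_of_grad_eq hU hv hu (grad_eq_of_rhoSq_nonpos ?_)
  have h := (energy_sub_bounds hu hmin hv).1.trans (sub_nonpos.2 (hvmin u hu))
  exact nonpos_of_mul_nonpos_right h (modulus_bounds hp.out).1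

theorem existsUnique_minimizer_and_energy_sub_bounds (f : StrongDual ℝ (W1p Ω p))
    (U : Submodule ℝ (W1p Ω p)) (hclosed : IsClosed (U : Set (W1p Ω p)))
    (hP : ∃ cP : ℝ, 0 < cP ∧ ∀ v ∈ U, ‖fn v‖ ≤ cP * ‖grad v‖) :
    (∃! u : W1p Ω p, u ∈ U ∧ ∀ v ∈ U, energy f u ≤ energy f v) ∧
      ∀ u ∈ U, (∀ v ∈ U, energy f u ≤ energy f v) → ∀ v ∈ U,
        ((1 / p * (1 - 1 / p) / 2)⁻¹)⁻¹ * rhoSq v u ≤ energy f v - energy f u ∧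
          energy f v - energy f u ≤ (1 / p * (1 - 1 / p) / 2)⁻¹ * rhoSq v u := by
  obtain ⟨cP, hcP, hU⟩ := hP
  refine ⟨existsUnique_minimizer f hclosed hcP hU, fun u hu hmin v hv => ?_⟩
  rw [inv_inv]
  exact energy_sub_bounds hu hmin hv

end PDirichlet

end

theorem mainTheorem1 (d : ℕ) :
    ∃ c : ℝ → ℝ, ContinuousOn c (Set.Ioi 1) ∧ (∀ p : ℝ, 1 < p → 0 < c p) ∧
      ∀ (p : ℝ) [Fact (1 < p)] (Ω : Set (EuclideanSpace ℝ (Fin d))),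
        IsOpen Ω → IsConnected Ω → Bornology.IsBounded Ω →
        ∀ (f : StrongDual ℝ (PDirichlet.W1p Ω p)) (U : Submodule ℝ (PDirichlet.W1p Ω p)),
          IsClosed (U : Set (PDirichlet.W1p Ω p)) →
          (∃ cP : ℝ, 0 < cP ∧ ∀ v ∈ U, ‖PDirichlet.fn v‖ ≤ cP * ‖PDirichlet.grad v‖) →
          (∃! u : PDirichlet.W1p Ω p, u ∈ U ∧
            ∀ v ∈ U, PDirichlet.energy f u ≤ PDirichlet.energy f v) ∧
          ∀ u ∈ U, (∀ v ∈ U, PDirichlet.energy f u ≤ PDirichlet.energy f v) →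
            ∀ v ∈ U,
              (c p)⁻¹ * PDirichlet.rhoSq v u ≤ PDirichlet.energy f v - PDirichlet.energy f u ∧
              PDirichlet.energy f v - PDirichlet.energy f u ≤ c p * PDirichlet.rhoSq v u := by
  refine ⟨fun p => (1 / p * (1 - 1 / p) / 2)⁻¹, ?_,
    fun p hp => inv_pos.2 (PDirichlet.modulus_bounds hp).1, ?_⟩
  · have hd : ContinuousOn (fun p : ℝ => 1 / p) (Set.Ioi 1) :=
      continuousOn_const.div continuousOn_id fun p hp => (zero_lt_one.trans hp).ne'
    exact ((hd.mul (continuousOn_const.sub hd)).div_const 2).inv₀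
      fun p hp => (PDirichlet.modulus_bounds hp).1.ne'
  · intro p _ Ω _ _ _ f U hclosed hP
    exact PDirichlet.existsUnique_minimizer_and_energy_sub_bounds f U hclosed hP
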